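/- Let $K$ be a field. Call a monoidal $K$-linear abelian category $\mathcal F$ (with $K$-bilinear tensor product) a *fusion category* if it is rigid (every object has a left and a right dual), semisimple (every object is a finite direct sum of simple objects), has only finitely many isomorphism classes of simple objects, and has finite-dimensional hom spaces; the unit object is not required to be simple. For an object $X$ let $X^*$ denote its (right) dual, given with maps $\mathbf 1\to X\otimes X^*$ and $X^*\otimes X\to\mathbf 1$ satisfying the duality equations. The endofunctor $X\mapsto X^{****}$ of $\mathcal F$ is regarded as a monoidal functor through the canonical isomorphisms $(X\otimes Y)^{**}\cong X^{**}\otimes Y^{**}$ and $\mathbf 1^{**}\cong\mathbf 1$. Then for every fusion category $\mathcal F$ the endofunctor $X\mapsto X^{****}$ is canonically and naturally monoidally isomorphic to the identity functor of $\mathcal F$. That is, one can assign to all fusion categories $\mathcal F$ over $K$ monoidal natural isomorphisms $$\gamma^{\mathcal F}\colon (-)^{****}\xrightarrow{\ \cong\ }\mathrm{Id}_{\mathcal F}$$ that are canonical in the following sense: they are preserved by all $K$-linear monoidal equivalences. Explicitly, for every $K$-linear monoidal equivalence $G\colon\mathcal F\to\mathcal F'$ of fusion categories and every $X\in\mathcal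 F$, the morphism $G(\gamma^{\mathcal F}_X)\colon G(X^{****})\to G(X)$ equals the composite of the canonical isomorphism $G(X^{****})\cong G(X)^{****}$ with $\gamma^{\mathcal F'}_{G(X)}$. (Applied to the identity functor, this says in particular that $\gamma^{\mathcal F}$ does not depend on the choice of duals.) -/

import Mathlib

open CategoryTheory MonoidalCategory CategoryTheory.Limits

universe w v u v₁ v₂ u₁ u₂

namespace QuadDual
noncomputable section

section Mate

/-! ### Exact pairings and transposes

`ExactPairing X Y` exhibits `Y` as a right dual of `X`, through `1 ⟶ X ⊗ Y` and `Y ⊗ X ⟶ 1`. -/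

variable {C : Type u} [Category.{v} C] [MonoidalCategory C]

/-- The transpose `f* : Y' ⟶ Y` of `f : X ⟶ X'`, with respect to a dual `Y` of `X` and a dual `Y'`
of `X'`. -/
def mate {X Y X' Y' : C} (p : ExactPairing X Y) (p' : ExactPairing X' Y') (f : X ⟶ X') :
    Y' ⟶ Y :=
  @rightAdjointMate C _ _ X X' (@HasRightDual.mk _ _ _ X Y p) (@HasRightDual.mk _ _ _ X' Y' p') f

theorem mate_id {X Y : C} (p : ExactPairing X Y) : mate p p (𝟙 X) = 𝟙 Y :=
  @rightAdjointMate_id C _ _ X ⟨Y⟩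

theorem mate_comp {X Y X' Y' X'' Y'' : C} (p : ExactPairing X Y) (p' : ExactPairing X' Y')
    (p'' : ExactPairing X'' Y'') (f : X ⟶ X') (g : X' ⟶ X'') :
    mate p p'' (f ≫ g) = mate p' p'' g ≫ mate p p' f :=
  @comp_rightAdjointMate C _ _ X X' X'' ⟨Y⟩ ⟨Y'⟩ ⟨Y''⟩ f g

theorem mate_evaluation {X Y X' Y' : C} (p : ExactPairing X Y) (p' : ExactPairing X' Y')
    (f : X ⟶ X') : mate p p' f ▷ X ≫ ε_ X Y = Y' ◁ f ≫ ε_ X' Y' :=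
  @rightAdjointMate_comp_evaluation C _ _ X X' ⟨Y⟩ ⟨Y'⟩ f

theorem eq_of_evaluation {X Y Z : C} (p : ExactPairing X Y) {a b : Z ⟶ Y}
    (h : a ▷ X ≫ ε_ X Y = b ▷ X ≫ ε_ X Y) : a = b := by
  have key : ∀ c : Z ⟶ Y, 𝟙 _ ⊗≫ Z ◁ η_ X Y ⊗≫ (c ▷ X ≫ ε_ X Y) ▷ Y ⊗≫ 𝟙 _ = c := by
    intro c
    calc _ = 𝟙 _ ⊗≫ (Z ◁ η_ X Y ≫ c ▷ (X ⊗ Y)) ⊗≫ ε_ X Y ▷ Y ⊗≫ 𝟙 _ := by monoidal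
      _ = c ⊗≫ (Y ◁ η_ X Y ⊗≫ ε_ X Y ▷ Y) ⊗≫ 𝟙 _ := by rw [whisker_exchange]; monoidal
      _ = c := by rw [ExactPairing.coevaluation_evaluation'']; monoidal
  rw [← key a, ← key b, h]

theorem mate_eq {X Y X' Y' : C} (p : ExactPairing X Y) (p' : ExactPairing X' Y')
    (f : X ⟶ X') (g : Y' ⟶ Y) (h : g ▷ X ≫ ε_ X Y = Y' ◁ f ≫ ε_ X' Y') : mate p p' f = g :=
  eq_of_evaluation p ((mate_evaluation p p' f).trans h.symm)

/-- `Y' ⊗ Y` as a dual of `X ⊗ X'`. -/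
abbrev tensorPairing {X Y X' Y' : C} (p : ExactPairing X Y) (q : ExactPairing X' Y') :
    ExactPairing (X ⊗ X') (Y' ⊗ Y) := ExactPairing.tensor

/-- The unit object as its own dual. -/
abbrev unitPairing : ExactPairing (𝟙_ C) (𝟙_ C) := exactPairingUnit

theorem mate_tensor {X Y X' Y' W Z W' Z' : C} (p : ExactPairing X Y) (p' : ExactPairing X' Y')
    (q : ExactPairing W Z) (q' : ExactPairing W' Z') (f : X ⟶ X') (g : W ⟶ W') :
    mate (tensorPairing p q) (tensorPairing p' q') (f ⊗ₘ g) = mate q q' g ⊗ₘ mate p p' f := by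
  apply mate_eq
  rw [ExactPairing.tensor_evaluation, ExactPairing.tensor_evaluation]
  calc _ = 𝟙 _ ⊗≫ mate q q' g ▷ (Y' ⊗ X ⊗ W) ⊗≫ Z ◁ (mate p p' f ▷ X ≫ ε_ X Y) ▷ W ⊗≫ ε_ W Z := by
        rw [MonoidalCategory.tensorHom_def]; monoidal
    _ = 𝟙 _ ⊗≫ (mate q q' g ▷ ((Y' ⊗ X) ⊗ W) ≫ Z ◁ ((Y' ◁ f ≫ ε_ X' Y') ▷ W)) ⊗≫ ε_ W Z := by
        rw [mate_evaluation p p']; monoidal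
    _ = 𝟙 _ ⊗≫ Z' ◁ ((Y' ◁ f ≫ ε_ X' Y') ▷ W) ⊗≫ (mate q q' g ▷ W ≫ ε_ W Z) := by
        rw [← whisker_exchange]; monoidal
    _ = 𝟙 _ ⊗≫ Z' ◁ Y' ◁ f ▷ W ⊗≫ Z' ◁ (ε_ X' Y' ▷ W ≫ 𝟙_ C ◁ g) ⊗≫ ε_ W' Z' := by
        rw [mate_evaluation q q']; monoidal
    _ = 𝟙 _ ⊗≫ Z' ◁ Y' ◁ (f ▷ W ≫ X' ◁ g) ⊗≫ Z' ◁ ε_ X' Y' ▷ W' ⊗≫ ε_ W' Z' := by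
        rw [← whisker_exchange]; monoidal
    _ = _ := by rw [MonoidalCategory.tensorHom_def]; monoidal

theorem mate_associator {X Y X' Y' X'' Y'' : C} (p : ExactPairing X Y) (p' : ExactPairing X' Y')
    (p'' : ExactPairing X'' Y'') :
    mate (tensorPairing (tensorPairing p p') p'') (tensorPairing p (tensorPairing p' p''))
      (α_ X X' X'').hom = (α_ Y'' Y' Y).hom := by
  apply mate_eq
  simp only [ExactPairing.tensor_evaluation]
  monoidal

theorem mate_leftUnitor {X Y : C} (p : ExactPairing X Y) :
    mate (tensorPairing unitPairing p) p (λ_ X).hom = (ρ_ Y).inv := by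
  apply mate_eq
  have h : ε_ (𝟙_ C) (𝟙_ C) = (ρ_ _).hom := rfl
  simp only [ExactPairing.tensor_evaluation, h]
  monoidal

theorem mate_rightUnitor {X Y : C} (p : ExactPairing X Y) :
    mate (tensorPairing p unitPairing) p (ρ_ X).hom = (λ_ Y).inv := by
  apply mate_eq
  have h : ε_ (𝟙_ C) (𝟙_ C) = (ρ_ _).hom := rfl
  simp only [ExactPairing.tensor_evaluation, h]
  monoidal

end Mate

/-- A monoidal functor preserves dual pairs. -/
@[reducible]
def mapPairing {C : Type u₁} [Category.{v₁} C] [MonoidalCategory C]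
    {D : Type u₂} [Category.{v₂} D] [MonoidalCategory D] (G : C ⥤ D) [G.Monoidal]
    {X Y : C} (p : ExactPairing X Y) : ExactPairing (G.obj X) (G.obj Y) where
  coevaluation' := Functor.LaxMonoidal.ε G ≫ G.map (η_ X Y) ≫ Functor.OplaxMonoidal.δ G X Y
  evaluation' := Functor.LaxMonoidal.μ G Y X ≫ G.map (ε_ X Y) ≫ Functor.OplaxMonoidal.η G
  coevaluation_evaluation' := by
    have h := congrArg G.map (ExactPairing.coevaluation_evaluation X Y)
    simp only [Functor.map_comp] at h
    simp only [MonoidalCategory.whiskerLeft_comp, comp_whiskerRight, Category.assoc,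
      Functor.Monoidal.map_associator_inv']
    simp only [Functor.Monoidal.whiskerLeft_δ_μ_assoc, Functor.Monoidal.whiskerRight_δ_μ_assoc,
      Functor.LaxMonoidal.μ_natural_right_assoc, Functor.OplaxMonoidal.δ_natural_left_assoc]
    rw [reassoc_of% h]
    simp
  evaluation_coevaluation' := by
    have h := congrArg G.map (ExactPairing.evaluation_coevaluation X Y)
    simp only [Functor.map_comp] at h
    simp only [MonoidalCategory.whiskerLeft_comp, comp_whiskerRight, Category.assoc,
      Functor.Monoidal.map_associator']
    simp only [Functor.Monoidal.whiskerLeft_δ_μ_assoc, Functor.Monoidal.whiskerRight_δ_μ_assoc,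
      Functor.LaxMonoidal.μ_natural_left_assoc, Functor.OplaxMonoidal.δ_natural_right_assoc]
    rw [reassoc_of% h]
    simp

section DoubleDual

/-! ### Double and quadruple duals -/

variable {C : Type u} [Category.{v} C] [MonoidalCategory C]

/-- The double transpose `f** : Z ⟶ Z'` of `f : X ⟶ X'`, where `Z`, `Z'` are double duals of
`X`, `X'` through the given pairings. -/
def doubleMate {X Y Z X' Y' Z' : C} (p : ExactPairing X Y) (q : ExactPairing Y Z)
    (p' : ExactPairing X' Y') (q' : ExactPairing Y' Z') (f : X ⟶ X') : Z ⟶ Z' :=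
  mate q' q (mate p p' f)

theorem doubleMate_id {X Y Z : C} (p : ExactPairing X Y) (q : ExactPairing Y Z) :
    doubleMate p q p q (𝟙 X) = 𝟙 Z := by
  simp only [doubleMate, mate_id]

theorem doubleMate_comp {X Y Z X' Y' Z' X'' Y'' Z'' : C} (p : ExactPairing X Y)
    (q : ExactPairing Y Z) (p' : ExactPairing X' Y') (q' : ExactPairing Y' Z')
    (p'' : ExactPairing X'' Y'') (q'' : ExactPairing Y'' Z'') (f : X ⟶ X') (g : X' ⟶ X'') :
    doubleMate p q p' q' f ≫ doubleMate p' q' p'' q'' g = doubleMate p q p'' q'' (f ≫ g) := by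
  simp only [doubleMate]
  rw [mate_comp p p' p'' f g, mate_comp q'' q' q]

theorem doubleMate_tensor {X Y Z X' Y' Z' U V W U' V' W' : C} (p : ExactPairing X Y)
    (q : ExactPairing Y Z) (p' : ExactPairing X' Y') (q' : ExactPairing Y' Z')
    (r : ExactPairing U V) (s : ExactPairing V W) (r' : ExactPairing U' V')
    (s' : ExactPairing V' W') (f : X ⟶ X') (g : U ⟶ U') :
    doubleMate (tensorPairing p r) (tensorPairing s q) (tensorPairing p' r')
      (tensorPairing s' q') (f ⊗ₘ g) = doubleMate p q p' q' f ⊗ₘ doubleMate r s r' s' g := by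
  simp only [doubleMate]
  rw [mate_tensor, mate_tensor]

theorem doubleMate_associator {X Y Z X' Y' Z' X'' Y'' Z'' : C} (p : ExactPairing X Y)
    (q : ExactPairing Y Z) (p' : ExactPairing X' Y') (q' : ExactPairing Y' Z')
    (p'' : ExactPairing X'' Y'') (q'' : ExactPairing Y'' Z'') :
    doubleMate (tensorPairing (tensorPairing p p') p'') (tensorPairing q'' (tensorPairing q' q))
      (tensorPairing p (tensorPairing p' p'')) (tensorPairing (tensorPairing q'' q') q)
      (α_ X X' X'').hom = (α_ Z Z' Z'').hom := by
  simp only [doubleMate]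
  rw [mate_associator, mate_associator]

theorem mate_rightUnitor_inv {X Y : C} (p : ExactPairing X Y) :
    mate p (tensorPairing p unitPairing) (ρ_ X).inv = (λ_ Y).hom := by
  rw [← cancel_epi (λ_ Y).inv, ← mate_rightUnitor p, ← mate_comp]
  simp [mate_id, mate_rightUnitor p]

theorem mate_leftUnitor_inv {X Y : C} (p : ExactPairing X Y) :
    mate p (tensorPairing unitPairing p) (λ_ X).inv = (ρ_ Y).hom := by
  rw [← cancel_epi (ρ_ Y).inv, ← mate_leftUnitor p, ← mate_comp]
  simp [mate_id, mate_leftUnitor p]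

theorem doubleMate_leftUnitor {X Y Z : C} (p : ExactPairing X Y) (q : ExactPairing Y Z) :
    doubleMate (tensorPairing unitPairing p) (tensorPairing q unitPairing) p q (λ_ X).hom =
      (λ_ Z).hom := by
  simp only [doubleMate]
  rw [mate_leftUnitor, mate_rightUnitor_inv]

theorem doubleMate_rightUnitor {X Y Z : C} (p : ExactPairing X Y) (q : ExactPairing Y Z) :
    doubleMate (tensorPairing p unitPairing) (tensorPairing unitPairing q) p q (ρ_ X).hom =
      (ρ_ Z).hom := by
  simp only [doubleMate]
  rw [mate_rightUnitor, mate_leftUnitor_inv]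

/-- The canonical isomorphism between two double duals of the same object. -/
@[simps]
def doubleMateIso {X Y Z Y' Z' : C} (p : ExactPairing X Y) (q : ExactPairing Y Z)
    (p' : ExactPairing X Y') (q' : ExactPairing Y' Z') : Z ≅ Z' where
  hom := doubleMate p q p' q' (𝟙 X)
  inv := doubleMate p' q' p q (𝟙 X)
  hom_inv_id := by rw [doubleMate_comp, Category.comp_id, doubleMate_id]
  inv_hom_id := by rw [doubleMate_comp, Category.comp_id, doubleMate_id]

variable [RightRigidCategory C]

/-- The (right) dual `X*`. -/
def rdual (X : C) : C := (RightRigidCategory.rightDual X).rightDual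

/-- The pairing between `X` and `X*`. -/
@[reducible]
def dualPairing (X : C) : ExactPairing X (rdual X) := (RightRigidCategory.rightDual X).exact

variable (C) in
/-- The endofunctor `X ↦ X**`. -/
def doubleDual : C ⥤ C where
  obj X := rdual (rdual X)
  map {X Y} f := doubleMate (dualPairing X) (dualPairing (rdual X)) (dualPairing Y)
    (dualPairing (rdual Y)) f
  map_id _ := doubleMate_id _ _
  map_comp f g := (doubleMate_comp _ _ _ _ _ _ f g).symm

/-- The pairing between `X*` and `X**`. -/
@[reducible]
def dualPairing' (X : C) : ExactPairing (rdual X) ((doubleDual C).obj X) := dualPairing (rdual X)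

theorem doubleDual_map_eq {X Y : C} (f : X ⟶ Y) :
    (doubleDual C).map f =
      doubleMate (dualPairing X) (dualPairing' X) (dualPairing Y) (dualPairing' Y) f := rfl

theorem doubleDual_id (X : C) :
    𝟙 ((doubleDual C).obj X) =
      doubleMate (dualPairing X) (dualPairing' X) (dualPairing X) (dualPairing' X) (𝟙 X) :=
  (doubleMate_id _ _).symm

variable (C) in
/-- The monoidal structure of `X ↦ X**`: `X** ⊗ Y**` and `(X ⊗ Y)**` are both double duals of
`X ⊗ Y`, hence canonically isomorphic; likewise `1` and `1**`. -/
def doubleDualCoreMonoidal : (doubleDual C).CoreMonoidal where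
  εIso := doubleMateIso unitPairing unitPairing (dualPairing (𝟙_ C)) (dualPairing' (𝟙_ C))
  μIso X Y := doubleMateIso (tensorPairing (dualPairing X) (dualPairing Y))
    (tensorPairing (dualPairing' Y) (dualPairing' X)) (dualPairing (X ⊗ Y)) (dualPairing' (X ⊗ Y))
  μIso_hom_natural_left f X' := by
    rw [← tensorHom_id, ← tensorHom_id, doubleDual_id]
    simp only [doubleDual_map_eq, doubleMateIso_hom]
    rw [← doubleMate_tensor, doubleMate_comp, doubleMate_comp]
    simp
  μIso_hom_natural_right X' f := by
    rw [← id_tensorHom, ← id_tensorHom, doubleDual_id]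
    simp only [doubleDual_map_eq, doubleMateIso_hom]
    rw [← doubleMate_tensor, doubleMate_comp, doubleMate_comp]
    simp
  associativity X Y Z := by
    rw [← tensorHom_id, ← id_tensorHom, doubleDual_id, doubleDual_id]
    simp only [doubleDual_map_eq, doubleMateIso_hom]
    rw [← doubleMate_tensor, ← doubleMate_tensor, doubleMate_comp, doubleMate_comp,
      doubleMate_comp, ← doubleMate_associator (dualPairing X) (dualPairing' X) (dualPairing Y)
        (dualPairing' Y) (dualPairing Z) (dualPairing' Z), doubleMate_comp]
    simp
  left_unitality X := by
    rw [← tensorHom_id, doubleDual_id]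
    simp only [doubleDual_map_eq, doubleMateIso_hom]
    rw [← doubleMate_tensor, doubleMate_comp, doubleMate_comp,
      ← doubleMate_leftUnitor (dualPairing X) (dualPairing' X)]
    simp
  right_unitality X := by
    rw [← id_tensorHom, doubleDual_id]
    simp only [doubleDual_map_eq, doubleMateIso_hom]
    rw [← doubleMate_tensor, doubleMate_comp, doubleMate_comp,
      ← doubleMate_rightUnitor (dualPairing X) (dualPairing' X)]
    simp

instance : (doubleDual C).Monoidal := (doubleDualCoreMonoidal C).toMonoidal

variable (C) in
/-- The endofunctor `X ↦ X****`, with its monoidal structure. -/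
abbrev quadrupleDual : C ⥤ C := doubleDual C ⋙ doubleDual C

end DoubleDual

section Comparison
variable {C : Type u₁} [Category.{v₁} C] [MonoidalCategory C] [RightRigidCategory C]
  {D : Type u₂} [Category.{v₂} D] [MonoidalCategory D] [RightRigidCategory D]

/-- The canonical isomorphism `G(X**) ≅ G(X)**` for a monoidal functor `G`: both sides are double
duals of `G(X)`. -/
def doubleDualComparison (G : C ⥤ D) [G.Monoidal] (X : C) :
    G.obj ((doubleDual C).obj X) ≅ (doubleDual D).obj (G.obj X) :=
  doubleMateIso (mapPairing G (dualPairing X)) (mapPairing G (dualPairing' X))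
    (dualPairing (G.obj X)) (dualPairing' (G.obj X))

/-- The canonical isomorphism `G(X****) ≅ G(X)****` for a monoidal functor `G`. -/
def quadrupleDualComparison (G : C ⥤ D) [G.Monoidal] (X : C) :
    G.obj ((quadrupleDual C).obj X) ≅ (quadrupleDual D).obj (G.obj X) :=
  doubleDualComparison G ((doubleDual C).obj X) ≪≫
    (doubleDual D).mapIso (doubleDualComparison G X)

end Comparison

end

section Fusion

/-! ### Fusion categories -/

attribute [local instance] Abelian.hasFiniteBiproducts

/-- A fusion category over a field `K` (the unit object is not required to be simple): a monoidal
`K`-linear abelian category, with `K`-bilinear tensor product, which is rigid and semisimple with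
finitely many isomorphism classes of simple objects and finite dimensional hom spaces. -/
structure FusionCategory (K : Type w) [Field K] where
  carrier : Type u
  [category : Category.{v} carrier]
  [abelian : Abelian carrier]
  [linear : Linear K carrier]
  [monoidal : MonoidalCategory carrier]
  [monoidalPreadditive : MonoidalPreadditive carrier]
  [monoidalLinear : MonoidalLinear K carrier]
  [rigid : RigidCategory carrier]
  semisimple : ∀ X : carrier, ∃ (n : ℕ) (S : Fin n → carrier),
    (∀ i, Simple (S i)) ∧ Nonempty (X ≅ ⨁ S)
  finite_simples : ∃ (n : ℕ) (S : Fin n → carrier),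
    ∀ X : carrier, Simple X → ∃ i, Nonempty (X ≅ S i)
  finite_hom : ∀ X Y : carrier, FiniteDimensional K (X ⟶ Y)

instance {K : Type w} [Field K] : CoeSort (FusionCategory.{w, v, u} K) (Type u) where
  coe F := F.carrier

attribute [instance] FusionCategory.category FusionCategory.abelian FusionCategory.linear
  FusionCategory.monoidal FusionCategory.monoidalPreadditive FusionCategory.monoidalLinear
  FusionCategory.rigid

end Fusion

end QuadDual

/-! With `Z = X**` and `U = X****`, closing a loop on the left sends `Z ⟶ X` to `End 1`, and closing
it on the right sends `Z ⟶ U` to `End 1`. Composing with a suitable functional `φ : End 1 → K` gives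
perfect pairings of `Hom(Z, A)` with `Hom(A, X)` and with `Hom(A, U)`. So `X` and `U` both represent
`A ↦ Hom(Z, A)^*`, and Yoneda yields `γ : U ≅ X`, characterized by `IsCanonical`
(`Detects.exists_isCanonical`). Cyclicity of the traces makes `γ` natural for arbitrary choices of
duals (`IsCanonical.naturality`). Partial traces on the two sides commute, so `γ ⊗ γ'` is again
canonical (`IsCanonical.tensor`); full monoidal functors compatible with the functionals preserve
canonical morphisms (`IsCanonical.map`). It remains to choose `φ` compatibly with equivalences
(`exists_unit_functional`). By semisimplicity `End 1` is reduced; being commutative and finite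
dimensional, it is a product of finite field extensions of `K`. Each factor gets a nonzero
functional invariant under automorphisms, chosen once per isomorphism class. -/

namespace QuadDual

/-! ### Invariant linear functionals on commutative algebras -/

/-- A finite field extension has a nonzero linear functional which is invariant under all
automorphisms. -/
theorem exists_invariant_functional_field (K : Type w) [Field K] (L : Type v) [Field L]
    [Algebra K L] [FiniteDimensional K L] :
    ∃ φ : L →ₗ[K] K, φ ≠ 0 ∧ ∀ (g : L ≃ₐ[K] L) (x : L), φ (g x) = φ x := by
  classical
  -- The field trace vanishes on inseparable extensions, so an arbitrary functional is averaged over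
  -- the automorphisms instead. Their sum is a nonzero map by Dedekind's independence of characters.
  have hne : ∃ x : L, ∑ g : L ≃ₐ[K] L, g x ≠ 0 := by
    by_contra! h
    have hli := (linearIndependent_algHom_toLinearMap K L L).comp
      (fun g : L ≃ₐ[K] L ↦ (g : L →ₐ[K] L)) AlgEquiv.coe_toAlgHom_injective
    have := Fintype.linearIndependent_iff.mp hli (fun _ ↦ 1) (by
      ext x
      simpa using h x) AlgEquiv.refl
    exact one_ne_zero this
  obtain ⟨x, hx⟩ := hne
  obtain ⟨ψ, hψ⟩ := Module.Projective.exists_dual_ne_zero K hx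
  refine ⟨ψ ∘ₗ ∑ g : L ≃ₐ[K] L, (g : L ≃ₗ[K] L).toLinearMap, ?_, fun g y ↦ ?_⟩
  · intro h
    apply hψ
    simpa using LinearMap.congr_fun h x
  · simp only [LinearMap.comp_apply, LinearMap.sum_apply]
    congr 1
    exact Fintype.sum_equiv (Equiv.mulRight g) _ _ fun _ ↦ rfl

/-- Nonzero linear functionals on all finite field extensions of `K`, compatible with
isomorphisms. -/
theorem exists_natural_functional_field (K : Type w) [Field K] :
    ∃ φ : ∀ (L : Type v) [Field L] [Algebra K L], L →ₗ[K] K,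
      (∀ (L : Type v) [Field L] [Algebra K L] [FiniteDimensional K L], φ L ≠ 0) ∧
      ∀ (L L' : Type v) [Field L] [Algebra K L] [FiniteDimensional K L] [Field L'] [Algebra K L']
        (e : L ≃ₐ[K] L') (x : L), φ L' (e x) = φ L x := by
  classical
  -- A functional is fixed on one representative of each isomorphism class and pulled back along an
  -- arbitrary isomorphism; invariance makes the choice of isomorphism irrelevant.
  let A := Σ' (L : Type v) (_ : Field L), Algebra K L
  let st : Setoid A :=
    { r := fun a b ↦ letI := a.2.1; letI := a.2.2; letI := b.2.1; letI := b.2.2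
        Nonempty (a.1 ≃ₐ[K] b.1)
      iseqv := ⟨fun a ↦ letI := a.2.1; letI := a.2.2; ⟨AlgEquiv.refl⟩,
        fun {a b} ⟨e⟩ ↦ letI := a.2.1; letI := a.2.2; letI := b.2.1; letI := b.2.2; ⟨e.symm⟩,
        fun {a b c} ⟨e⟩ ⟨f⟩ ↦ letI := a.2.1; letI := a.2.2; letI := b.2.1; letI := b.2.2
          letI := c.2.1; letI := c.2.2; ⟨e.trans f⟩⟩ }
  let (c : Quotient st) : Field c.out.1 := c.out.2.1
  let (c : Quotient st) : Algebra K c.out.1 := c.out.2.2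
  have h₀ (c : Quotient st) : ∃ φ : c.out.1 →ₗ[K] K, FiniteDimensional K c.out.1 →
      φ ≠ 0 ∧ ∀ (g : c.out.1 ≃ₐ[K] c.out.1) x, φ (g x) = φ x := by
    by_cases h : FiniteDimensional K c.out.1
    · obtain ⟨φ, hφ⟩ := exists_invariant_functional_field K c.out.1
      exact ⟨φ, fun _ ↦ hφ⟩
    · exact ⟨0, fun h' ↦ absurd h' h⟩
  choose φ hφ using h₀
  let cl (L : Type v) [Field L] [Algebra K L] : Quotient st := ⟦⟨L, ‹_›, ‹_›⟩⟧
  have he (L : Type v) [Field L] [Algebra K L] : Nonempty (L ≃ₐ[K] (cl L).out.1) := by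
    obtain ⟨e⟩ := Quotient.mk_out (s := st) ⟨L, ‹_›, ‹_›⟩
    exact ⟨e.symm⟩
  let e (L : Type v) [Field L] [Algebra K L] : L ≃ₐ[K] (cl L).out.1 := (he L).some
  refine ⟨fun L _ _ ↦ φ (cl L) ∘ₗ (e L).toLinearMap, fun L _ _ _ h ↦ ?_,
    fun L L' _ _ _ _ _ f x ↦ ?_⟩
  · have : FiniteDimensional K (cl L).out.1 := (e L).toLinearEquiv.finiteDimensional
    apply (hφ (cl L) inferInstance).1
    ext y
    simpa using LinearMap.congr_fun h ((e L).symm y)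
  · have hcl : cl L = cl L' := Quotient.sound (s := st) ⟨f⟩
    have key : ∀ (c : Quotient st) (a : L ≃ₐ[K] c.out.1) (b : L' ≃ₐ[K] c.out.1),
        φ c (b (f x)) = φ c (a x) := by
      intro c a b
      have : FiniteDimensional K c.out.1 := a.toLinearEquiv.finiteDimensional
      simpa using (hφ c inferInstance).2 ((a.symm.trans f).trans b) (a x)
    -- The class is a variable here so that the equality of classes can be substituted in the types
    -- depending on it.
    have key' : ∀ (c : Quotient st) (_ : c = cl L') (a : L ≃ₐ[K] c.out.1),
        φ (cl L') (e L' (f x)) = φ c (a x) := by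
      rintro c rfl a
      exact key _ a _
    exact key' _ hcl (e L)

/-- Linear functionals on all commutative `K`-algebras, compatible with isomorphisms and
nondegenerate on the finite reduced algebras. -/
theorem exists_natural_functional (K : Type w) [Field K] :
    ∃ φ : ∀ (R : Type v) [CommRing R] [Algebra K R], R →ₗ[K] K,
      (∀ (R : Type v) [CommRing R] [Algebra K R] [FiniteDimensional K R] [IsReduced R] (r : R),
        r ≠ 0 → ∃ s, φ R (s * r) ≠ 0) ∧
      ∀ (R R' : Type v) [CommRing R] [Algebra K R] [FiniteDimensional K R] [CommRing R']
        [Algebra K R'] (e : R ≃ₐ[K] R') (x : R), φ R' (e x) = φ R x := by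
  classical
  obtain ⟨φ, hφ, hφ'⟩ := exists_natural_functional_field.{w, v} K
  let (R : Type v) [CommRing R] (m : MaximalSpectrum R) : Field (R ⧸ m.asIdeal) :=
    Ideal.Quotient.field _
  -- The sum runs over all residue fields; `∑ᶠ` gives it a meaning when there are infinitely many
  -- maximal ideals.
  refine ⟨fun R _ _ ↦ ∑ᶠ m : MaximalSpectrum R,
    φ (R ⧸ m.asIdeal) ∘ₗ (Ideal.Quotient.mkₐ K m.asIdeal).toLinearMap, ?_, ?_⟩
  · intro R _ _ _ _ r hr
    have : IsArtinianRing R := IsArtinianRing.of_finite K R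
    have := Fintype.ofFinite (MaximalSpectrum R)
    -- A reduced Artinian ring is the product of its residue fields.
    obtain ⟨m, hm⟩ : ∃ m : MaximalSpectrum R, Ideal.Quotient.mk m.asIdeal r ≠ 0 := by
      by_contra! h
      apply hr
      apply (IsArtinianRing.equivPi R).injective
      ext m
      simpa using h m
    obtain ⟨y, hy⟩ : ∃ y, φ (R ⧸ m.asIdeal) y ≠ 0 := by
      by_contra! h
      exact hφ (R ⧸ m.asIdeal) (LinearMap.ext h)
    -- Multiplied by `r`, this element becomes `y` in the factor at `m` and `0` in all others.
    refine ⟨(IsArtinianRing.equivPi R).symm (Pi.single m (y * (Ideal.Quotient.mk m.asIdeal r)⁻¹)),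
      ?_⟩
    have hs : ∀ n : MaximalSpectrum R, Ideal.Quotient.mk n.asIdeal
        ((IsArtinianRing.equivPi R).symm (Pi.single m (y * (Ideal.Quotient.mk m.asIdeal r)⁻¹))) =
        Pi.single (M := fun n : MaximalSpectrum R ↦ R ⧸ n.asIdeal) m
          (y * (Ideal.Quotient.mk m.asIdeal r)⁻¹) n := by
      intro n
      rw [← IsArtinianRing.equivPi_apply, AlgEquiv.apply_symm_apply]
    beta_reduce
    rw [finsum_eq_sum_of_fintype, LinearMap.sum_apply, Finset.sum_eq_single m]
    · simpa [hs, hm] using hy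
    · intro n _ hn
      simp [hs, hn]
    · simp
  · intro R R' _ _ _ _ _ e x
    have : FiniteDimensional K R' := e.toLinearEquiv.finiteDimensional
    have : IsArtinianRing R := IsArtinianRing.of_finite K R
    have : IsArtinianRing R' := IsArtinianRing.of_finite K R'
    have := Fintype.ofFinite (MaximalSpectrum R)
    have := Fintype.ofFinite (MaximalSpectrum R')
    beta_reduce
    rw [finsum_eq_sum_of_fintype, finsum_eq_sum_of_fintype, LinearMap.sum_apply,
      LinearMap.sum_apply]
    let t : MaximalSpectrum R ≃ MaximalSpectrum R' :=
      { toFun := fun m ↦ ⟨m.asIdeal.comap (e.symm : R' →+* R),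
          have := m.isMaximal; Ideal.comap_isMaximal_of_surjective _ e.symm.surjective⟩
        invFun := fun m ↦ ⟨m.asIdeal.comap (e : R →+* R'),
          have := m.isMaximal; Ideal.comap_isMaximal_of_surjective _ e.surjective⟩
        left_inv := fun m ↦ by ext y; simp
        right_inv := fun m ↦ by ext y; simp }
    refine (Fintype.sum_equiv t _ _ fun m ↦ ?_).symm
    have h : (t m).asIdeal = m.asIdeal.map (e : R →+* R') := by
      ext y
      rw [Ideal.mem_map_iff_of_surjective (e : R →+* R') e.surjective]
      exact ⟨fun hy ↦ ⟨e.symm y, hy, by simp⟩, by rintro ⟨z, hz, rfl⟩; simpa [t] using hz⟩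
    exact (hφ' _ _ (Ideal.quotientEquivAlg _ _ e h) (Ideal.Quotient.mk _ x)).symm

/-! ### Partial traces attached to dual pairs -/

section Traces

variable {C : Type u} [Category.{v} C] [MonoidalCategory C]

/-- The trace `1 ⟶ Y ⊗ Z ⟶ Y ⊗ X ⟶ 1` of a morphism from the double dual `Z` of `X` to `X`. -/
def leftTrace {X Y Z : C} (p : ExactPairing X Y) (q : ExactPairing Y Z) (k : Z ⟶ X) :
    𝟙_ C ⟶ 𝟙_ C :=
  η_ Y Z ≫ Y ◁ k ≫ ε_ X Y

/-- The trace `1 ⟶ X ⊗ Y ⟶ Z ⊗ Y ⟶ 1` of a morphism from `X` to its double dual `Z`. -/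
def rightTrace {X Y Z : C} (p : ExactPairing X Y) (q : ExactPairing Y Z) (h : X ⟶ Z) :
    𝟙_ C ⟶ 𝟙_ C :=
  η_ X Y ≫ h ▷ Y ≫ ε_ Y Z

theorem coevaluation_mate {X Y X' Y' : C} (p : ExactPairing X Y) (p' : ExactPairing X' Y')
    (f : X ⟶ X') : η_ X' Y' ≫ X' ◁ mate p p' f = η_ X Y ≫ f ▷ Y :=
  @coevaluation_comp_rightAdjointMate C _ _ X X' ⟨Y⟩ ⟨Y'⟩ f

/-- Cyclicity: `f` slides around the loop, transposed once at each of the two bends. -/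
theorem leftTrace_comp {X Y Z X' Y' Z' : C} (p : ExactPairing X Y) (q : ExactPairing Y Z)
    (p' : ExactPairing X' Y') (q' : ExactPairing Y' Z') (f : X ⟶ X') (k : Z' ⟶ X) :
    leftTrace p' q' (k ≫ f) = leftTrace p q (doubleMate p q p' q' f ≫ k) := by
  simp only [leftTrace, doubleMate, MonoidalCategory.whiskerLeft_comp, Category.assoc]
  rw [reassoc_of% coevaluation_mate q' q (mate p p' f), ← mate_evaluation p p' f,
    whisker_exchange_assoc]

theorem rightTrace_comp {X Y Z X' Y' Z' : C} (p : ExactPairing X Y) (q : ExactPairing Y Z)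
    (p' : ExactPairing X' Y') (q' : ExactPairing Y' Z') (f : X ⟶ X') (h : X' ⟶ Z) :
    rightTrace p' q' (h ≫ doubleMate p q p' q' f) = rightTrace p q (f ≫ h) := by
  simp only [rightTrace, doubleMate, comp_whiskerRight, Category.assoc]
  rw [← reassoc_of% coevaluation_mate p p' f, mate_evaluation q' q (mate p p' f),
    whisker_exchange_assoc]

/-- The partial left trace over the first tensor factor. -/
def partialLeftTrace {X Y Z : C} (p : ExactPairing X Y) (q : ExactPairing Y Z) {A B : C}
    (k : Z ⊗ A ⟶ X ⊗ B) : A ⟶ B :=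
  (λ_ A).inv ≫ η_ Y Z ▷ A ≫ (α_ _ _ _).hom ≫ Y ◁ k ≫ (α_ _ _ _).inv ≫ ε_ X Y ▷ B ≫ (λ_ B).hom

/-- The partial right trace over the last tensor factor. -/
def partialRightTrace {X Y Z : C} (p : ExactPairing X Y) (q : ExactPairing Y Z) {A B : C}
    (h : A ⊗ X ⟶ B ⊗ Z) : A ⟶ B :=
  (ρ_ A).inv ≫ A ◁ η_ X Y ≫ (α_ _ _ _).inv ≫ h ▷ Y ≫ (α_ _ _ _).hom ≫ B ◁ ε_ Y Z ≫ (ρ_ B).hom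

theorem partialLeftTrace_comp {X Y Z : C} (p : ExactPairing X Y) (q : ExactPairing Y Z)
    {A B B' : C} (k : Z ⊗ A ⟶ X ⊗ B) (g : B ⟶ B') :
    partialLeftTrace p q (k ≫ X ◁ g) = partialLeftTrace p q k ≫ g := by
  simp only [partialLeftTrace, MonoidalCategory.whiskerLeft_comp, Category.assoc]
  rw [associator_inv_naturality_right_assoc, whisker_exchange_assoc, id_whiskerLeft]
  simp

theorem partialRightTrace_comp {X Y Z : C} (p : ExactPairing X Y) (q : ExactPairing Y Z)
    {A B B' : C} (h : A ⊗ X ⟶ B ⊗ Z) (g : B ⟶ B') :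
    partialRightTrace p q (h ≫ g ▷ Z) = partialRightTrace p q h ≫ g := by
  simp only [partialRightTrace, comp_whiskerRight, Category.assoc]
  rw [associator_naturality_left_assoc, ← whisker_exchange_assoc, whiskerRight_id]
  simp

/-- The loops are nested. On the left the first factor closes innermost; on the right the last one
does. -/
theorem leftTrace_tensor {X Y Z X' Y' Z' : C} (p : ExactPairing X Y) (q : ExactPairing Y Z)
    (p' : ExactPairing X' Y') (q' : ExactPairing Y' Z') (k : Z ⊗ Z' ⟶ X ⊗ X') :
    leftTrace (tensorPairing p p') (tensorPairing q' q) k =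
      leftTrace p' q' (partialLeftTrace p q k) := by
  simp only [leftTrace, partialLeftTrace, ExactPairing.tensor_evaluation,
    ExactPairing.tensor_coevaluation]
  monoidal

theorem rightTrace_tensor {X Y Z X' Y' Z' : C} (p : ExactPairing X Y) (q : ExactPairing Y Z)
    (p' : ExactPairing X' Y') (q' : ExactPairing Y' Z') (h : X ⊗ X' ⟶ Z ⊗ Z') :
    rightTrace (tensorPairing p p') (tensorPairing q' q) h =
      rightTrace p q (partialRightTrace p' q' h) := by
  simp only [rightTrace, partialRightTrace, ExactPairing.tensor_evaluation,
    ExactPairing.tensor_coevaluation]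
  monoidal

/-- The two loops lie on opposite sides of `h`, so the interchange law lets them close in either
order. -/
theorem leftTrace_partialRightTrace {X Y Z X' Y' Z' : C} (p : ExactPairing X Y)
    (q : ExactPairing Y Z) (p' : ExactPairing X' Y') (q' : ExactPairing Y' Z')
    (h : Z ⊗ X' ⟶ X ⊗ Z') :
    leftTrace p q (partialRightTrace p' q' h) = rightTrace p' q' (partialLeftTrace p q h) := by
  simp only [leftTrace, rightTrace, partialRightTrace, partialLeftTrace]
  calc _ = 𝟙 _ ⊗≫ (η_ Y Z ▷ 𝟙_ C ≫ (Y ⊗ Z) ◁ η_ X' Y') ⊗≫ Y ◁ h ▷ Y' ⊗≫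
        ((Y ⊗ X) ◁ ε_ Y' Z' ≫ ε_ X Y ▷ 𝟙_ C) ⊗≫ 𝟙 _ := by monoidal
    _ = _ := by rw [← whisker_exchange, whisker_exchange (ε_ X Y)]; monoidal

theorem leftTrace_unit (k : 𝟙_ C ⟶ 𝟙_ C) :
    leftTrace (unitPairing (C := C)) unitPairing k = k := by
  have h : ε_ (𝟙_ C) (𝟙_ C) = (ρ_ _).hom := rfl
  have h' : η_ (𝟙_ C) (𝟙_ C) = (ρ_ _).inv := rfl
  simp only [leftTrace, h, h']
  monoidal

theorem rightTrace_unit (k : 𝟙_ C ⟶ 𝟙_ C) :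
    rightTrace (unitPairing (C := C)) unitPairing k = k := by
  have h : ε_ (𝟙_ C) (𝟙_ C) = (ρ_ _).hom := rfl
  have h' : η_ (𝟙_ C) (𝟙_ C) = (ρ_ _).inv := rfl
  simp only [rightTrace, h, h']
  monoidal

theorem leftTrace_mapPairing {D : Type u₂} [Category.{v₂} D] [MonoidalCategory D] (G : C ⥤ D)
    [G.Monoidal] {X Y Z : C} (p : ExactPairing X Y) (q : ExactPairing Y Z) (k : Z ⟶ X) :
    leftTrace (mapPairing G p) (mapPairing G q) (G.map k) =
      Functor.LaxMonoidal.ε G ≫ G.map (leftTrace p q k) ≫ Functor.OplaxMonoidal.η G := by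
  change (Functor.LaxMonoidal.ε G ≫ G.map (η_ Y Z) ≫ Functor.OplaxMonoidal.δ G Y Z) ≫ _ ≫
    Functor.LaxMonoidal.μ G Y X ≫ G.map (ε_ X Y) ≫ Functor.OplaxMonoidal.η G = _
  simp [leftTrace]

theorem rightTrace_mapPairing {D : Type u₂} [Category.{v₂} D] [MonoidalCategory D] (G : C ⥤ D)
    [G.Monoidal] {X Y Z : C} (p : ExactPairing X Y) (q : ExactPairing Y Z) (h : X ⟶ Z) :
    rightTrace (mapPairing G p) (mapPairing G q) (G.map h) =
      Functor.LaxMonoidal.ε G ≫ G.map (rightTrace p q h) ≫ Functor.OplaxMonoidal.η G := by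
  change (Functor.LaxMonoidal.ε G ≫ G.map (η_ X Y) ≫ Functor.OplaxMonoidal.δ G X Y) ≫ _ ≫
    Functor.LaxMonoidal.μ G Z Y ≫ G.map (ε_ Y Z) ≫ Functor.OplaxMonoidal.η G = _
  simp [rightTrace]

end Traces

attribute [local instance] Abelian.hasFiniteBiproducts

/-! ### Nondegenerate functionals on the endomorphisms of the unit -/

section Semisimple

variable {K : Type w} [Field K] (F : FusionCategory.{w, v, u} K)

/-- A nonzero morphism in a semisimple category is partially split. -/
theorem FusionCategory.exists_split {B B' : F} (x : B ⟶ B') (hx : x ≠ 0) :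
    ∃ (g : B' ⟶ B) (T : F) (π : B' ⟶ T), π ≠ 0 ∧ g ≫ x ≫ π = π := by
  obtain ⟨n, S, hS, ⟨e⟩⟩ := F.semisimple B
  obtain ⟨m, T, hT, ⟨f⟩⟩ := F.semisimple B'
  obtain ⟨i, j, hij⟩ : ∃ i j, (biproduct.ι S i ≫ e.inv) ≫ x ≫ f.hom ≫ biproduct.π T j ≠ 0 := by
    by_contra! h
    apply hx
    rw [← cancel_epi e.inv, ← cancel_mono f.hom]
    ext i j
    simpa using h j i
  have := hS i
  have := hT j
  have := isIso_of_hom_simple hij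
  -- By Schur's lemma the nonzero matrix entry of `x` from `S i` to `T j` is invertible; `g` goes
  -- back through its inverse.
  refine ⟨(f.hom ≫ biproduct.π T j) ≫ inv ((biproduct.ι S i ≫ e.inv) ≫ x ≫ f.hom ≫
    biproduct.π T j) ≫ (biproduct.ι S i ≫ e.inv), T j, f.hom ≫ biproduct.π T j, fun h ↦ ?_, ?_⟩
  · apply id_nonzero (T j)
    have h' : (biproduct.ι T j ≫ f.inv) ≫ f.hom ≫ biproduct.π T j = 𝟙 _ := by simp
    rw [← h', h, comp_zero]
  · have h := IsIso.inv_hom_id ((biproduct.ι S i ≫ e.inv) ≫ x ≫ f.hom ≫ biproduct.π T j)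
    simp only [Category.assoc] at h ⊢
    rw [h, Category.comp_id]

end Semisimple

section UnitEnd

variable {C : Type u} [Category.{v} C] [MonoidalCategory C]

/-- The Eckmann–Hilton argument. -/
theorem unit_end_comm (r s : 𝟙_ C ⟶ 𝟙_ C) : r ≫ s = s ≫ r := by
  have h := whisker_exchange r s
  rw [id_whiskerLeft, whiskerRight_id] at h
  simpa [unitors_equal, unitors_inv_equal] using h.symm

variable [Preadditive C]

/-- The commutative ring of endomorphisms of the unit object. -/
abbrev unitEndCommRing : CommRing (End (𝟙_ C)) :=
  { (inferInstance : Ring (End (𝟙_ C))) with mul_comm := fun r s ↦ unit_end_comm s r }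

attribute [local instance] unitEndCommRing

/-- If `r ≠ 0`, some `g` and `π ≠ 0` satisfy `g ≫ r ≫ π = π`, so every power of `r * g` fixes `π`.
By commutativity these powers would eventually vanish if `r` were nilpotent. -/
theorem FusionCategory.isReduced_unitEnd {K : Type w} [Field K] (F : FusionCategory.{w, v, u} K) :
    IsReduced (End (𝟙_ F)) := by
  refine ⟨fun r hr ↦ ?_⟩
  by_contra hne
  obtain ⟨g, T, π, hπ, h⟩ := F.exists_split (show 𝟙_ F ⟶ 𝟙_ F from r) hne
  let g' : End (𝟙_ F) := g
  have key (n : ℕ) : (show 𝟙_ F ⟶ 𝟙_ F from (r * g') ^ n) ≫ π = π := by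
    induction n with
    | zero => exact Category.id_comp π
    | succ n ih =>
      rw [pow_succ]
      change ((g ≫ r) ≫ (show 𝟙_ F ⟶ 𝟙_ F from (r * g') ^ n)) ≫ π = π
      rw [Category.assoc, ih, Category.assoc, h]
  obtain ⟨n, hn⟩ := hr
  apply hπ
  rw [← key n, mul_pow, hn, zero_mul]
  exact zero_comp

variable {K : Type w} [Field K] [Linear K C]

/-- The functional `φ` detects nonzero morphisms into and out of the unit object. -/
structure Detects (φ : (𝟙_ C ⟶ 𝟙_ C) →ₗ[K] K) : Prop where
  left : ∀ {B : C} (x : B ⟶ 𝟙_ C), x ≠ 0 → ∃ g : 𝟙_ C ⟶ B, φ (g ≫ x) ≠ 0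
  right : ∀ {B : C} (x : 𝟙_ C ⟶ B), x ≠ 0 → ∃ g : B ⟶ 𝟙_ C, φ (x ≫ g) ≠ 0

/-- The algebra isomorphism of the endomorphisms of the units induced by a monoidal
equivalence. -/
noncomputable def unitEndEquiv {D : Type u₂} [Category.{v₂} D] [MonoidalCategory D]
    [Preadditive D] [Linear K D] (G : C ⥤ D) [G.Monoidal] [G.Additive] [G.Linear K]
    [G.IsEquivalence] : End (𝟙_ C) ≃ₐ[K] End (𝟙_ D) :=
  AlgEquiv.ofBijective
    (AlgHom.ofLinearMap
      { toFun := fun r : End (𝟙_ C) ↦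
          (Functor.LaxMonoidal.ε G ≫ G.map r ≫ Functor.OplaxMonoidal.η G : 𝟙_ D ⟶ 𝟙_ D)
        map_add' := fun r s ↦ by
          change Functor.LaxMonoidal.ε G ≫ G.map ((r : 𝟙_ C ⟶ 𝟙_ C) + s) ≫ _ = _
          rw [Functor.map_add, Preadditive.add_comp, Preadditive.comp_add]
        map_smul' := fun a r ↦ by
          change Functor.LaxMonoidal.ε G ≫ G.map (a • (r : 𝟙_ C ⟶ 𝟙_ C)) ≫ _ = _
          rw [Functor.map_smul, Linear.smul_comp, Linear.comp_smul]
          rfl }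
      (by
        change Functor.LaxMonoidal.ε G ≫ G.map (𝟙 (𝟙_ C)) ≫ Functor.OplaxMonoidal.η G = 𝟙 _
        simp)
      (fun r s ↦ by
        change Functor.LaxMonoidal.ε G ≫ G.map ((s : 𝟙_ C ⟶ 𝟙_ C) ≫ r) ≫
          Functor.OplaxMonoidal.η G = (Functor.LaxMonoidal.ε G ≫ G.map s ≫
          Functor.OplaxMonoidal.η G) ≫ Functor.LaxMonoidal.ε G ≫ G.map r ≫
          Functor.OplaxMonoidal.η G
        simp))
    (by
      constructor
      · intro r s h
        apply G.map_injective
        replace h : Functor.LaxMonoidal.ε G ≫ G.map r ≫ Functor.OplaxMonoidal.η G =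
          Functor.LaxMonoidal.ε G ≫ G.map s ≫ Functor.OplaxMonoidal.η G := h
        exact (cancel_mono _).mp ((cancel_epi _).mp h)
      · intro r
        refine ⟨G.preimage (Functor.OplaxMonoidal.η G ≫ (show 𝟙_ D ⟶ 𝟙_ D from r) ≫
          Functor.LaxMonoidal.ε G), ?_⟩
        change Functor.LaxMonoidal.ε G ≫ G.map (G.preimage _) ≫ Functor.OplaxMonoidal.η G = r
        simp)

/-- Functionals on the endomorphisms of the units of all fusion categories, which detect nonzero
morphisms and are preserved by all linear monoidal equivalences. -/
theorem exists_unit_functional (K : Type w) [Field K] :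
    ∃ φ : ∀ F : FusionCategory.{w, v, u} K, (𝟙_ F ⟶ 𝟙_ F) →ₗ[K] K, (∀ F, Detects (φ F)) ∧
      ∀ (F F' : FusionCategory.{w, v, u} K) (G : F ⥤ F') [G.Monoidal] [G.Linear K]
        [G.IsEquivalence] (r : 𝟙_ F ⟶ 𝟙_ F),
        φ F' (Functor.LaxMonoidal.ε G ≫ G.map r ≫ Functor.OplaxMonoidal.η G) = φ F r := by
  obtain ⟨φ, hφ, hφ'⟩ := exists_natural_functional.{w, v} K
  have hfin (F : FusionCategory.{w, v, u} K) : FiniteDimensional K (End (𝟙_ F)) :=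
    F.finite_hom (𝟙_ F) (𝟙_ F)
  have hd (F : FusionCategory.{w, v, u} K) (r : 𝟙_ F ⟶ 𝟙_ F) (hr : r ≠ 0) :
      ∃ s : 𝟙_ F ⟶ 𝟙_ F, φ (End (𝟙_ F)) (r ≫ s) ≠ 0 :=
    haveI := F.isReduced_unitEnd
    hφ (End (𝟙_ F)) r hr
  refine ⟨fun F ↦ φ (End (𝟙_ F)), fun F ↦ ⟨fun x hx ↦ ?_, fun x hx ↦ ?_⟩, fun F F' G _ _ _ r ↦ ?_⟩
  · obtain ⟨g, T, π, hπ, h⟩ := F.exists_split x hx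
    obtain ⟨s, hs⟩ := hd F (g ≫ x) fun h0 ↦ hπ (by rw [← h, reassoc_of% h0, zero_comp])
    exact ⟨s ≫ g, by rwa [Category.assoc, ← unit_end_comm]⟩
  · obtain ⟨g, T, π, hπ, h⟩ := F.exists_split x hx
    -- Using the splitting twice writes `π` as `g ≫ x ≫ g ≫ x ≫ π`, which contains `x ≫ g`.
    obtain ⟨s, hs⟩ := hd F (x ≫ g) fun h0 ↦ hπ (by
      rw [← h, ← h, reassoc_of% h0, zero_comp, comp_zero])
    exact ⟨g ≫ s, by rwa [← Category.assoc]⟩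
  · have : G.Additive := Functor.additive_of_preserves_binary_products G
    exact hφ' _ _ (unitEndEquiv (K := K) G) r

end UnitEnd

/-! ### The isomorphism between an object and its quadruple dual -/

section Quadruple

variable {K : Type w} [Field K] {C : Type u} [Category.{v} C] [MonoidalCategory C]
  [Preadditive C] [Linear K C]

/-- The property which characterizes the canonical morphism `γ : U ⟶ X` from the quadruple dual `U`
of `X`: it exchanges the right trace with the left trace. -/
def IsCanonical (φ : (𝟙_ C ⟶ 𝟙_ C) →ₗ[K] K) {X Y Z V U : C} (p : ExactPairing X Y)
    (q : ExactPairing Y Z) (r : ExactPairing Z V) (s : ExactPairing V U) (γ : U ⟶ X) : Prop :=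
  ∀ h : Z ⟶ U, φ (leftTrace p q (h ≫ γ)) = φ (rightTrace r s h)

variable {φ : (𝟙_ C ⟶ 𝟙_ C) →ₗ[K] K}

theorem isCanonical_unit (φ : (𝟙_ C ⟶ 𝟙_ C) →ₗ[K] K) :
    IsCanonical φ unitPairing unitPairing unitPairing unitPairing (𝟙 (𝟙_ C)) := by
  intro h
  rw [leftTrace_unit, rightTrace_unit, Category.comp_id]

/-- In the nested left trace, `γ'` turns the outer loop into a right loop. The interchange of loops
then exposes the other one to `γ`, and the result is the nested right trace. -/
theorem IsCanonical.tensor {X Y Z V U X' Y' Z' V' U' : C}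
    {p : ExactPairing X Y} {q : ExactPairing Y Z} {r : ExactPairing Z V} {s : ExactPairing V U}
    {γ : U ⟶ X} (hγ : IsCanonical φ p q r s γ)
    {p' : ExactPairing X' Y'} {q' : ExactPairing Y' Z'} {r' : ExactPairing Z' V'}
    {s' : ExactPairing V' U'} {γ' : U' ⟶ X'} (hγ' : IsCanonical φ p' q' r' s' γ') :
    IsCanonical φ (tensorPairing p p') (tensorPairing q' q) (tensorPairing r r')
      (tensorPairing s' s) (γ ⊗ₘ γ') := by
  intro h
  rw [MonoidalCategory.tensorHom_def, ← Category.assoc, leftTrace_tensor, partialLeftTrace_comp,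
    hγ', ← leftTrace_partialRightTrace, partialRightTrace_comp, hγ, ← rightTrace_tensor]

/-- Monoidal functors preserve traces, and fullness ensures that every test morphism comes from `C`.
-/
theorem IsCanonical.map {D : Type u₂} [Category.{v₂} D] [MonoidalCategory D] [Preadditive D]
    [Linear K D] (G : C ⥤ D) [G.Monoidal] [G.Full] {ψ : (𝟙_ D ⟶ 𝟙_ D) →ₗ[K] K}
    (hψ : ∀ k, ψ (Functor.LaxMonoidal.ε G ≫ G.map k ≫ Functor.OplaxMonoidal.η G) = φ k)
    {X Y Z V U : C} {p : ExactPairing X Y} {q : ExactPairing Y Z} {r : ExactPairing Z V}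
    {s : ExactPairing V U} {γ : U ⟶ X} (hγ : IsCanonical φ p q r s γ) :
    IsCanonical ψ (mapPairing G p) (mapPairing G q) (mapPairing G r) (mapPairing G s)
      (G.map γ) := by
  intro h
  obtain ⟨h, rfl⟩ := G.map_surjective h
  rw [← G.map_comp, leftTrace_mapPairing, rightTrace_mapPairing, hψ, hψ, hγ]

variable [MonoidalPreadditive C]

/-! ### Nondegeneracy of the trace pairings -/

/-- Bending `v` by duality gives a nonzero `Y ⊗ A ⟶ 1`. Since `φ` detects it through some `1 ⟶ Y ⊗
A`, bending the latter back gives `u`. The next three lemmas are the variants for the other argument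
and the other side. -/
theorem Detects.exists_leftTrace_ne_zero_left (hφ : Detects φ) {X Y Z A : C}
    (p : ExactPairing X Y) (q : ExactPairing Y Z) (v : A ⟶ X) (hv : v ≠ 0) :
    ∃ u : Z ⟶ A, φ (leftTrace p q (u ≫ v)) ≠ 0 := by
  have hx : Y ◁ v ≫ ε_ X Y ≠ 0 := by
    intro h0
    have h := @tensorLeftHomEquiv_whiskerLeft_comp_evaluation C _ _ A Y
      (@HasLeftDual.mk _ _ _ Y X p) v
    change tensorLeftHomEquiv A X Y _ (Y ◁ v ≫ ε_ X Y) = _ at h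
    rw [h0] at h
    apply hv
    rw [← cancel_mono (ρ_ X).inv, zero_comp]
    exact h.symm.trans (by simp [tensorLeftHomEquiv])
  obtain ⟨g, hg⟩ := hφ.left _ hx
  refine ⟨(ρ_ Z).inv ≫ (tensorLeftHomEquiv _ Y Z _).symm g, ?_⟩
  have h : η_ Y Z ≫ Y ◁ ((ρ_ Z).inv ≫ (tensorLeftHomEquiv _ Y Z _).symm g) = g := by
    apply (tensorLeftHomEquiv _ Y Z _).symm.injective
    rw [tensorLeftHomEquiv_symm_coevaluation_comp_whiskerLeft, Iso.hom_inv_id_assoc]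
  rw [leftTrace, MonoidalCategory.whiskerLeft_comp, Category.assoc, reassoc_of% h]
  exact hg

theorem Detects.exists_leftTrace_ne_zero_right (hφ : Detects φ) {X Y Z A : C}
    (p : ExactPairing X Y) (q : ExactPairing Y Z) (u : Z ⟶ A) (hu : u ≠ 0) :
    ∃ v : A ⟶ X, φ (leftTrace p q (u ≫ v)) ≠ 0 := by
  have hx : η_ Y Z ≫ Y ◁ u ≠ 0 := by
    intro h0
    have h := tensorLeftHomEquiv_symm_coevaluation_comp_whiskerLeft (Y := Y) u
    rw [h0] at h
    apply hu
    rw [← cancel_epi (ρ_ Z).hom, comp_zero]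
    exact h.symm.trans (by simp [tensorLeftHomEquiv])
  obtain ⟨g, hg⟩ := hφ.right _ hx
  refine ⟨tensorLeftHomEquiv _ X Y _ g ≫ (ρ_ X).hom, ?_⟩
  have h : Y ◁ (tensorLeftHomEquiv _ X Y _ g ≫ (ρ_ X).hom) ≫ ε_ X Y = g := by
    apply (tensorLeftHomEquiv _ X Y _).injective
    exact (@tensorLeftHomEquiv_whiskerLeft_comp_evaluation C _ _ A Y
      (@HasLeftDual.mk _ _ _ Y X p) _).trans (by simp)
  rw [leftTrace, MonoidalCategory.whiskerLeft_comp, Category.assoc, h, ← Category.assoc]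
  exact hg

theorem Detects.exists_rightTrace_ne_zero_left (hφ : Detects φ) {X Y Z A : C}
    (p : ExactPairing X Y) (q : ExactPairing Y Z) (v : A ⟶ Z) (hv : v ≠ 0) :
    ∃ u : X ⟶ A, φ (rightTrace p q (u ≫ v)) ≠ 0 := by
  have hx : v ▷ Y ≫ ε_ Y Z ≠ 0 := by
    intro h0
    have h := @tensorRightHomEquiv_whiskerRight_comp_evaluation C _ _ Y A
      (@HasRightDual.mk _ _ _ Y Z q) v
    change tensorRightHomEquiv A Y Z _ (v ▷ Y ≫ ε_ Y Z) = _ at h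
    rw [h0] at h
    apply hv
    rw [← cancel_mono (λ_ Z).inv, zero_comp]
    exact h.symm.trans (by simp [tensorRightHomEquiv])
  obtain ⟨g, hg⟩ := hφ.left _ hx
  refine ⟨(λ_ X).inv ≫ (tensorRightHomEquiv _ X Y _).symm g, ?_⟩
  have h : η_ X Y ≫ ((λ_ X).inv ≫ (tensorRightHomEquiv _ X Y _).symm g) ▷ Y = g := by
    apply (tensorRightHomEquiv _ X Y _).symm.injective
    rw [tensorRightHomEquiv_symm_coevaluation_comp_whiskerRight, Iso.hom_inv_id_assoc]
  rw [rightTrace, comp_whiskerRight, Category.assoc, reassoc_of% h]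
  exact hg

theorem Detects.exists_rightTrace_ne_zero_right (hφ : Detects φ) {X Y Z A : C}
    (p : ExactPairing X Y) (q : ExactPairing Y Z) (u : X ⟶ A) (hu : u ≠ 0) :
    ∃ v : A ⟶ Z, φ (rightTrace p q (u ≫ v)) ≠ 0 := by
  have hx : η_ X Y ≫ u ▷ Y ≠ 0 := by
    intro h0
    have h := tensorRightHomEquiv_symm_coevaluation_comp_whiskerRight (Y' := Y) u
    rw [h0] at h
    apply hu
    rw [← cancel_epi (λ_ X).hom, comp_zero]
    exact h.symm.trans (by simp [tensorRightHomEquiv])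
  obtain ⟨g, hg⟩ := hφ.right _ hx
  refine ⟨tensorRightHomEquiv _ Y Z _ g ≫ (λ_ Z).hom, ?_⟩
  have h : (tensorRightHomEquiv _ Y Z _ g ≫ (λ_ Z).hom) ▷ Y ≫ ε_ Y Z = g := by
    apply (tensorRightHomEquiv _ Y Z _).injective
    exact (@tensorRightHomEquiv_whiskerRight_comp_evaluation C _ _ Y A
      (@HasRightDual.mk _ _ _ Y Z q) _).trans (by simp)
  rw [rightTrace, comp_whiskerRight, Category.assoc, h, ← Category.assoc]
  exact hg

variable [MonoidalLinear K C]

/-- The pairing `u, v ↦ φ (leftTrace (u ≫ v))`. -/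
def leftForm (φ : (𝟙_ C ⟶ 𝟙_ C) →ₗ[K] K) {X Y Z : C} (p : ExactPairing X Y)
    (q : ExactPairing Y Z) (A : C) : (Z ⟶ A) →ₗ[K] (A ⟶ X) →ₗ[K] K :=
  LinearMap.mk₂ K (fun u v ↦ φ (leftTrace p q (u ≫ v)))
    (by simp [leftTrace]) (by simp [leftTrace]) (by simp [leftTrace]) (by simp [leftTrace])

/-- The pairing `u, v ↦ φ (rightTrace (u ≫ v))`. -/
def rightForm (φ : (𝟙_ C ⟶ 𝟙_ C) →ₗ[K] K) {X Y Z : C} (p : ExactPairing X Y)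
    (q : ExactPairing Y Z) (A : C) : (X ⟶ A) →ₗ[K] (A ⟶ Z) →ₗ[K] K :=
  LinearMap.mk₂ K (fun u v ↦ φ (rightTrace p q (u ≫ v)))
    (by simp [rightTrace]) (by simp [rightTrace]) (by simp [rightTrace]) (by simp [rightTrace])

/-- Morphisms into `X` are determined by their left traces. -/
theorem Detects.eq_of_leftTrace (hφ : Detects φ) {X Y Z A : C} (p : ExactPairing X Y)
    (q : ExactPairing Y Z) {a b : A ⟶ X}
    (h : ∀ u : Z ⟶ A, φ (leftTrace p q (u ≫ a)) = φ (leftTrace p q (u ≫ b))) : a = b := by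
  by_contra hab
  obtain ⟨u, hu⟩ := hφ.exists_leftTrace_ne_zero_left p q (a - b) (sub_ne_zero.mpr hab)
  apply hu
  have := map_sub (leftForm φ p q A u) a b
  exact this.trans (sub_eq_zero.mpr (h u))

/-- Morphisms into `Z` are determined by their right traces. -/
theorem Detects.eq_of_rightTrace (hφ : Detects φ) {X Y Z A : C} (p : ExactPairing X Y)
    (q : ExactPairing Y Z) {a b : A ⟶ Z}
    (h : ∀ u : X ⟶ A, φ (rightTrace p q (u ≫ a)) = φ (rightTrace p q (u ≫ b))) : a = b := by
  by_contra hab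
  obtain ⟨u, hu⟩ := hφ.exists_rightTrace_ne_zero_left p q (a - b) (sub_ne_zero.mpr hab)
  apply hu
  have := map_sub (rightForm φ p q A u) a b
  exact this.trans (sub_eq_zero.mpr (h u))

/-- Nondegenerate in both arguments and finite dimensional in one, the pairing is perfect. -/
theorem Detects.exists_leftTrace_eq (hφ : Detects φ) {X Y Z A : C} (p : ExactPairing X Y)
    (q : ExactPairing Y Z) [FiniteDimensional K (Z ⟶ A)] (l : (Z ⟶ A) →ₗ[K] K) :
    ∃ v : A ⟶ X, ∀ u : Z ⟶ A, φ (leftTrace p q (u ≫ v)) = l u := by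
  have : (leftForm φ p q A).IsPerfPair := by
    apply LinearMap.IsPerfPair.of_injective
    · rw [injective_iff_map_eq_zero]
      intro u hu
      by_contra hne
      obtain ⟨v, hv⟩ := hφ.exists_leftTrace_ne_zero_right p q u hne
      exact hv (LinearMap.congr_fun hu v)
    · rw [injective_iff_map_eq_zero]
      intro v hv
      by_contra hne
      obtain ⟨u, hu⟩ := hφ.exists_leftTrace_ne_zero_left p q v hne
      exact hu (LinearMap.congr_fun hv u)
  exact ⟨(leftForm φ p q A).flip.toPerfPair.symm l, fun u ↦
    LinearMap.apply_toPerfPair_flip (leftForm φ p q A) l u⟩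

theorem Detects.exists_rightTrace_eq (hφ : Detects φ) {X Y Z A : C} (p : ExactPairing X Y)
    (q : ExactPairing Y Z) [FiniteDimensional K (X ⟶ A)] (l : (X ⟶ A) →ₗ[K] K) :
    ∃ v : A ⟶ Z, ∀ u : X ⟶ A, φ (rightTrace p q (u ≫ v)) = l u := by
  have : (rightForm φ p q A).IsPerfPair := by
    apply LinearMap.IsPerfPair.of_injective
    · rw [injective_iff_map_eq_zero]
      intro u hu
      by_contra hne
      obtain ⟨v, hv⟩ := hφ.exists_rightTrace_ne_zero_right p q u hne
      exact hv (LinearMap.congr_fun hu v)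
    · rw [injective_iff_map_eq_zero]
      intro v hv
      by_contra hne
      obtain ⟨u, hu⟩ := hφ.exists_rightTrace_ne_zero_left p q v hne
      exact hu (LinearMap.congr_fun hv u)
  exact ⟨(rightForm φ p q A).flip.toPerfPair.symm l, fun u ↦
    LinearMap.apply_toPerfPair_flip (rightForm φ p q A) l u⟩

/-- Yoneda made explicit: `γ` represents the right trace through the left pairing, and `δ`
represents the left trace through the right pairing. Nondegeneracy shows that they are mutually
inverse. -/
theorem Detects.exists_isCanonical (hφ : Detects φ) {X Y Z V U : C} (p : ExactPairing X Y)
    (q : ExactPairing Y Z) (r : ExactPairing Z V) (s : ExactPairing V U)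
    [FiniteDimensional K (Z ⟶ U)] [FiniteDimensional K (Z ⟶ X)] :
    ∃ γ : U ≅ X, IsCanonical φ p q r s γ.hom := by
  obtain ⟨γ, hγ⟩ := hφ.exists_leftTrace_eq p q ((rightForm φ r s U).flip (𝟙 U))
  obtain ⟨δ, hδ⟩ := hφ.exists_rightTrace_eq r s ((leftForm φ p q X).flip (𝟙 X))
  replace hγ : IsCanonical φ p q r s γ := fun h ↦ (hγ h).trans
    (congrArg (fun k ↦ φ (rightTrace r s k)) (Category.comp_id h))
  replace hδ : ∀ k : Z ⟶ X, φ (rightTrace r s (k ≫ δ)) = φ (leftTrace p q k) := fun k ↦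
    (hδ k).trans (congrArg (fun k ↦ φ (leftTrace p q k)) (Category.comp_id k))
  refine ⟨⟨γ, δ, hφ.eq_of_rightTrace r s fun u ↦ ?_, hφ.eq_of_leftTrace p q fun u ↦ ?_⟩, hγ⟩
  · rw [← Category.assoc, hδ, hγ, Category.comp_id]
  · rw [← Category.assoc, hγ, hδ, Category.comp_id]

/-- The canonical morphisms are natural, and independent of the choice of duals. -/
theorem IsCanonical.naturality (hφ : Detects φ) {X Y Z V U X' Y' Z' V' U' : C}
    {p : ExactPairing X Y} {q : ExactPairing Y Z} {r : ExactPairing Z V} {s : ExactPairing V U}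
    {γ : U ⟶ X} (hγ : IsCanonical φ p q r s γ)
    {p' : ExactPairing X' Y'} {q' : ExactPairing Y' Z'} {r' : ExactPairing Z' V'}
    {s' : ExactPairing V' U'} {γ' : U' ⟶ X'} (hγ' : IsCanonical φ p' q' r' s' γ') (f : X ⟶ X') :
    doubleMate r s r' s' (doubleMate p q p' q' f) ≫ γ' = γ ≫ f := by
  refine hφ.eq_of_leftTrace p' q' fun h ↦ ?_
  -- Both sides reduce to the right trace of `doubleMate p q p' q' f ≫ h`: one by `γ'` and right
  -- cyclicity, the other by left cyclicity and `γ`.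
  rw [← Category.assoc, ← Category.assoc, hγ', rightTrace_comp, leftTrace_comp p q,
    ← Category.assoc, hγ]

end Quadruple

/-! ### Structure maps of the quadruple dual as iterated transposes of identities -/

theorem quadrupleDualComparison_hom {C : Type u₁} [Category.{v₁} C] [MonoidalCategory C]
    [RightRigidCategory C] {D : Type u₂} [Category.{v₂} D] [MonoidalCategory D]
    [RightRigidCategory D] (G : C ⥤ D) [G.Monoidal] (X : C) :
    (quadrupleDualComparison G X).hom =
      doubleMate (mapPairing G (dualPairing ((doubleDual C).obj X)))
        (mapPairing G (dualPairing' ((doubleDual C).obj X)))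
        (dualPairing ((doubleDual D).obj (G.obj X))) (dualPairing' ((doubleDual D).obj (G.obj X)))
        (doubleMate (mapPairing G (dualPairing X)) (mapPairing G (dualPairing' X))
          (dualPairing (G.obj X)) (dualPairing' (G.obj X)) (𝟙 (G.obj X))) := by
  simp only [quadrupleDualComparison, doubleDualComparison, Iso.trans_hom, Functor.mapIso_hom,
    doubleMateIso_hom, doubleDual_map_eq]
  rw [doubleMate_comp, Category.id_comp]

section QuadrupleDualMonoidal

variable {C : Type u} [Category.{v} C] [MonoidalCategory C] [RightRigidCategory C]

theorem quadrupleDual_ε :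
    Functor.LaxMonoidal.ε (quadrupleDual C) =
      doubleMate unitPairing unitPairing (dualPairing ((doubleDual C).obj (𝟙_ C)))
        (dualPairing' ((doubleDual C).obj (𝟙_ C))) (doubleMate unitPairing unitPairing
          (dualPairing (𝟙_ C)) (dualPairing' (𝟙_ C)) (𝟙 (𝟙_ C))) := by
  rw [Functor.LaxMonoidal.comp_ε, doubleDual_map_eq]
  change doubleMate unitPairing unitPairing (dualPairing (𝟙_ C)) (dualPairing' (𝟙_ C)) (𝟙 (𝟙_ C)) ≫
    doubleMate _ _ _ _ (doubleMate unitPairing unitPairing (dualPairing (𝟙_ C))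
      (dualPairing' (𝟙_ C)) (𝟙 (𝟙_ C))) = _
  rw [doubleMate_comp, Category.id_comp]

theorem quadrupleDual_μ (X Y : C) :
    Functor.LaxMonoidal.μ (quadrupleDual C) X Y =
      doubleMate
        (tensorPairing (dualPairing ((doubleDual C).obj X)) (dualPairing ((doubleDual C).obj Y)))
        (tensorPairing (dualPairing' ((doubleDual C).obj Y))
          (dualPairing' ((doubleDual C).obj X)))
        (dualPairing ((doubleDual C).obj (X ⊗ Y))) (dualPairing' ((doubleDual C).obj (X ⊗ Y)))
        (doubleMate (tensorPairing (dualPairing X) (dualPairing Y))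
          (tensorPairing (dualPairing' Y) (dualPairing' X)) (dualPairing (X ⊗ Y))
          (dualPairing' (X ⊗ Y)) (𝟙 (X ⊗ Y))) := by
  rw [Functor.LaxMonoidal.comp_μ, doubleDual_map_eq]
  change doubleMate (tensorPairing (dualPairing ((doubleDual C).obj X))
      (dualPairing ((doubleDual C).obj Y))) (tensorPairing (dualPairing' ((doubleDual C).obj Y))
      (dualPairing' ((doubleDual C).obj X))) _ _ (𝟙 _) ≫ doubleMate _ _ _ _ (doubleMate
        (tensorPairing (dualPairing X) (dualPairing Y)) (tensorPairing (dualPairing' Y)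
        (dualPairing' X)) (dualPairing (X ⊗ Y)) (dualPairing' (X ⊗ Y)) (𝟙 (X ⊗ Y))) = _
  rw [doubleMate_comp, Category.id_comp]

end QuadrupleDualMonoidal

end QuadDual

theorem mainTheorem9 (K : Type w) [Field K] :
    ∃ γ : ∀ F : QuadDual.FusionCategory.{w, v, u} K, QuadDual.quadrupleDual F ≅ 𝟭 F,
      (∀ F : QuadDual.FusionCategory.{w, v, u} K, NatTrans.IsMonoidal (γ F).hom) ∧
      ∀ (F F' : QuadDual.FusionCategory.{w, v, u} K) (G : F ⥤ F') [G.Monoidal] [G.Linear K]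
        [G.IsEquivalence] (X : F),
        G.map ((γ F).hom.app X) =
          (QuadDual.quadrupleDualComparison G X).hom ≫ (γ F').hom.app (G.obj X) := by
  obtain ⟨φ, hφ, hG⟩ := QuadDual.exists_unit_functional.{w, v, u} K
  have hγ (F : QuadDual.FusionCategory.{w, v, u} K) (X : F) :
      ∃ γ : (QuadDual.quadrupleDual F).obj X ≅ X,
        QuadDual.IsCanonical (φ F) (QuadDual.dualPairing X) (QuadDual.dualPairing' X)
          (QuadDual.dualPairing ((QuadDual.doubleDual F).obj X))
          (QuadDual.dualPairing' ((QuadDual.doubleDual F).obj X)) γ.hom :=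
    haveI := F.finite_hom
    (hφ F).exists_isCanonical _ _ _ _
  choose γ hγ using hγ
  refine ⟨fun F ↦ NatIso.ofComponents (γ F) fun {X X'} f ↦
    (hγ F X).naturality (hφ F) (hγ F X') f, fun F ↦ ⟨?_, fun X Y ↦ ?_⟩, fun F F' G _ _ _ X ↦ ?_⟩
  -- Each remaining identity compares canonical morphisms for two systems of duals of the same
  -- object: it is naturality at an identity morphism.
  · rw [QuadDual.quadrupleDual_ε]
    exact ((QuadDual.isCanonical_unit (φ F)).naturality (hφ F) (hγ F _) (𝟙 _)).trans
      (Category.comp_id _)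
  · rw [QuadDual.quadrupleDual_μ]
    exact ((hγ F X).tensor (hγ F Y)).naturality (hφ F) (hγ F _) (𝟙 _)
  · rw [QuadDual.quadrupleDualComparison_hom]
    exact ((((hγ F X).map G (hG F F' G)).naturality (hφ F') (hγ F' (G.obj X)) (𝟙 _)).trans
      (Category.comp_id _)).symm
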